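/- Let $\mathcal{A}$ be a complex unital Banach algebra with unit $1$. An element $x\in\mathcal{A}$ is called generalized Drazin invertible if there is $x^d\in\mathcal{A}$ (necessarily unique) such that $x^d x x^d=x^d$, $xx^d=x^dx$ and $x-x^2x^d$ is quasinilpotent (has spectral radius $0$). Let $\mathcal{A}^d$ denote the set of these elements, and for $x\in\mathcal{A}^d$ put $x^\pi=1-xx^d$. Let $a,b\in\mathcal{A}^d$ satisfy $a^\pi b a=a^\pi b^\pi a b b^\pi a^\pi$, and suppose that at least one of the six elements $$a^\pi b a^\pi,\quad a^\pi b,\quad b a^\pi,\quad aa^d b aa^d,\quad aa^d b,\quad b aa^d$$ belongs to $\mathcal{A}^d$. Put $e=(a+b)aa^d$. Then $$a+b\in\mathcal{A}^d\iff aa^d(a+b)\in\mathcal{A}^d\iff e\in\mathcal{A}^d\iff aa^d(a+b)aa^d\in\mathcal{A}^d .$$ If these equivalent conditions hold, then $$\begin{aligned} (a+b)^d={}&e^d+\sum_{n=0}^{\infty}a^\pi a^n(b^d)^{n+1}-\sum_{n=0}^{\infty}e^d b a^\pi a^n(b^d)^{n+1}\\ &+\sum_{n=0}^{\infty}\sum_{k=0}^{\infty}e^\pi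 e^n aa^d b a^k a^\pi (b^d)^{n+k+2} +\sum_{n=0}^{\infty}(e^d)^{n+2}b a^\pi(a+b)^n b^\pi\\ &-\sum_{n=0}^{\infty}\sum_{k=0}^{\infty}(e^d)^{n+2}b a^\pi(a+b)^n a^{k+1}(b^d)^{k+1}, \end{aligned}$$ where all the series converge unconditionally in $\mathcal{A}$, the double series as series over $(n,k)\in\mathbb{N}\times\mathbb{N}$. -/

import Mathlib

/-- `a` is quasinilpotent: its spectral radius vanishes. -/
def IsQuasinilpotent {A : Type*} [NormedRing A] [NormedAlgebra ℂ A] (a : A) : Prop :=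
  spectralRadius ℂ a = 0

/-- `x` is a generalized Drazin (Koliha-Drazin) inverse of `a`. -/
structure IsGDrazinInverse {A : Type*} [NormedRing A] [NormedAlgebra ℂ A] (a x : A) : Prop where
  outer : x * a * x = x
  comm : a * x = x * a
  quasinil : IsQuasinilpotent (a - a ^ 2 * x)

/-- `a` is generalized Drazin invertible, i.e. `a ∈ A^d`. -/
def IsGDrazinInvertible {A : Type*} [NormedRing A] [NormedAlgebra ℂ A] (a : A) : Prop :=
  ∃ x : A, IsGDrazinInverse a x

open Classical in
/-- The generalized Drazin inverse `a^d`, with the value `0` if `a` has none. -/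
noncomputable def gDrazin {A : Type*} [NormedRing A] [NormedAlgebra ℂ A] (a : A) : A :=
  if h : IsGDrazinInvertible a then h.choose else 0

/-- The spectral idempotent `a^π = 1 - a a^d`. -/
noncomputable def spectralIdem {A : Type*} [NormedRing A] [NormedAlgebra ℂ A] (a : A) : A :=
  1 - a * gDrazin a

theorem gDrazin_spec {A : Type*} [NormedRing A] [NormedAlgebra ℂ A] {a : A}
    (h : IsGDrazinInvertible a) : IsGDrazinInverse a (gDrazin a) := by
  rw [gDrazin, dif_pos h]
  exact h.choose_spec

/-- If `‖z‖ ≤ ‖x ^ n‖ * ‖y ^ n‖` for all `n ≥ 1` and `y` is quasinilpotent, then `z = 0`. -/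
theorem eq_zero_of_norm_le_pow_mul_pow {A : Type*} [NormedRing A] [NormedAlgebra ℂ A]
    [CompleteSpace A] {x y z : A} (hy : IsQuasinilpotent y)
    (hz : ∀ n : ℕ, 1 ≤ n → ‖z‖ ≤ ‖x ^ n‖ * ‖y ^ n‖) : z = 0 := by
  have hlim := spectrum.pow_norm_pow_one_div_tendsto_nhds_spectralRadius y
  rw [show spectralRadius ℂ y = 0 from hy] at hlim
  set ε : ℝ := 1 / (2 * (‖x‖ + 1)) with hε
  have hεpos : 0 < ε := by positivity
  have hev := hlim.eventually (gt_mem_nhds (ENNReal.ofReal_pos.2 hεpos))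
  have hbound : ∀ᶠ n : ℕ in Filter.atTop, ‖z‖ ≤ (1 / 2 : ℝ) ^ n := by
    filter_upwards [hev, Filter.eventually_ge_atTop 1] with n hn h1
    have hn' : ‖y ^ n‖ ^ (1 / n : ℝ) < ε := (ENNReal.ofReal_lt_ofReal_iff hεpos).1 hn
    have hyn : ‖y ^ n‖ ≤ ε ^ n := by
      have h2 : (‖y ^ n‖ ^ (1 / n : ℝ)) ^ n ≤ ε ^ n :=
        pow_le_pow_left₀ (by positivity) hn'.le n
      rwa [one_div, Real.rpow_inv_natCast_pow (norm_nonneg _) (by omega)] at h2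
    calc ‖z‖ ≤ ‖x ^ n‖ * ‖y ^ n‖ := hz n h1
      _ ≤ (‖x‖ + 1) ^ n * ε ^ n := by
        refine mul_le_mul ?_ hyn (norm_nonneg _) (by positivity)
        exact (norm_pow_le' x (show 0 < n by omega)).trans
          (pow_le_pow_left₀ (norm_nonneg _) (by linarith) n)
      _ = (1 / 2 : ℝ) ^ n := by
        rw [← mul_pow]
        congr 1
        rw [hε]
        field_simp
  have h0 : Filter.Tendsto (fun n : ℕ => (1 / 2 : ℝ) ^ n) Filter.atTop (nhds 0) :=
    tendsto_pow_atTop_nhds_zero_of_lt_one (by norm_num) (by norm_num)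
  exact norm_le_zero_iff.1 (ge_of_tendsto h0 hbound)

/-- The idempotents `x * a` and `1 - a * y` of two generalized Drazin inverses of `a`
annihilate each other. -/
theorem IsGDrazinInverse.idem_mul {A : Type*} [NormedRing A] [NormedAlgebra ℂ A]
    [CompleteSpace A] {a x y : A} (hx : IsGDrazinInverse a x) (hy : IsGDrazinInverse a y) :
    x * a * (1 - a * y) = 0 ∧ (1 - a * y) * (x * a) = 0 := by
  have hqidem : (1 - a * y) * (1 - a * y) = 1 - a * y := by
    have h : a * y * (a * y) = a * y := by
      calc a * y * (a * y) = a * (y * a * y) := by noncomm_ring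
        _ = a * y := by rw [hy.outer]
    rw [sub_mul, mul_sub, mul_sub, h]
    simp
  have hqc : Commute a (1 - a * y) := by
    show a * (1 - a * y) = (1 - a * y) * a
    rw [mul_sub, sub_mul, mul_one, one_mul, mul_assoc, ← hy.comm]
  have hpidem : IsIdempotentElem (x * a) := by
    show x * a * (x * a) = x * a
    rw [← mul_assoc, hx.outer]
  have hquasi : a - a ^ 2 * y = a * (1 - a * y) := by noncomm_ring
  have hxa : Commute x a := hx.comm.symm
  have hq : ∀ n : ℕ, 1 ≤ n → (1 - a * y) ^ n = 1 - a * y := fun n hn =>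
    IsIdempotentElem.pow_eq (show IsIdempotentElem (1 - a * y) from hqidem) (by omega)
  have hp : ∀ n : ℕ, 1 ≤ n → (x * a) ^ n = x * a := fun n hn => hpidem.pow_eq (by omega)
  have hquasi' : IsQuasinilpotent (a * (1 - a * y)) := hquasi ▸ hy.quasinil
  constructor
  · refine eq_zero_of_norm_le_pow_mul_pow (x := x) hquasi' fun n hn => ?_
    have h : x * a * (1 - a * y) = x ^ n * (a * (1 - a * y)) ^ n := by
      rw [hqc.mul_pow, hq n hn, ← mul_assoc, ← hxa.mul_pow, hp n hn]
    rw [h]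
    exact norm_mul_le _ _
  · refine eq_zero_of_norm_le_pow_mul_pow (x := x) hquasi' fun n hn => ?_
    have h : (1 - a * y) * (x * a) = (a * (1 - a * y)) ^ n * x ^ n := by
      rw [hqc.eq, hqc.symm.mul_pow, hq n hn, mul_assoc, ← hxa.symm.mul_pow, ← hxa.eq, hp n hn]
    rw [h, mul_comm ‖x ^ n‖]
    exact norm_mul_le _ _

/-- A generalized Drazin inverse is unique. -/
theorem IsGDrazinInverse.unique {A : Type*} [NormedRing A] [NormedAlgebra ℂ A]
    [CompleteSpace A] {a x y : A} (hx : IsGDrazinInverse a x) (hy : IsGDrazinInverse a y) :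
    x = y := by
  have h1 : x * a = a * y * (x * a) := by
    have h := (hx.idem_mul hy).2
    rwa [sub_mul, one_mul, sub_eq_zero] at h
  have h2 : y * a = y * a * (a * x) := by
    have h := (hy.idem_mul hx).1
    rwa [mul_sub, mul_one, sub_eq_zero] at h
  have hpq : x * a = y * a := by
    rw [h1, hy.comm, ← hx.comm, ← h2]
  calc x = x * a * x := hx.outer.symm
    _ = y * a * x := by rw [hpq]
    _ = y * (x * a) := by rw [mul_assoc, hx.comm]
    _ = y * a * y := by rw [hpq, mul_assoc, hy.comm]
    _ = y := hy.outer

/-- The value of `gDrazin` is determined by the defining relations. -/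
theorem IsGDrazinInverse.gDrazin_eq {A : Type*} [NormedRing A] [NormedAlgebra ℂ A]
    [CompleteSpace A] {a x : A} (hx : IsGDrazinInverse a x) : gDrazin a = x :=
  (gDrazin_spec ⟨x, hx⟩).unique hx

/-!
With respect to the idempotent `u = a^π` the element `a` is block diagonal, and the hypothesis on
`a^π b a` makes `b`, hence `a + b`, block triangular. Any one of the six invertibility hypotheses
makes `b^d` block triangular too, by Cline's formula and the naturality of the generalized Drazin
inverse with respect to intertwining relations. The `u`-block of `a + b` is then a quasinilpotent
perturbation of that of `b`, and its generalized Drazin inverse `T = ∑ u aⁿ (b^d)ⁿ⁺¹` has the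
powers `Tᵐ⁺¹ = ∑ u aⁿ (b^d)ⁿ⁺ᵐ⁺¹`. The other diagonal block is `e`, so `a + b` is generalized
Drazin invertible exactly when `e` is. With `z` the off-diagonal block of `a + b` and `y` its
`u`-block, that of `(a + b)^d` solves a Sylvester equation, and equals
`∑ e^π eⁿ z Tⁿ⁺² + ∑ (e^d)ⁿ⁺² z yⁿ y^π - e^d z T`.
-/

section Compression

variable {M : Type*} [Monoid M] {u v w : M}

theorem mul_mul_mul_of_semiconjBy (hv : SemiconjBy u v (u * v)) (w : M) :
    u * v * (u * w) = u * (v * w) := by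
  rw [← mul_assoc, ← hv.eq, mul_assoc]

theorem semiconjBy_mul_mul (hv : SemiconjBy u v (u * v)) (hw : SemiconjBy u w (u * w)) :
    SemiconjBy u (v * w) (u * (v * w)) :=
  mul_mul_mul_of_semiconjBy hv w ▸ hv.mul_right hw

theorem mul_pow_succ_of_semiconjBy (hw : SemiconjBy u w (u * w)) (n : ℕ) :
    (u * w) ^ (n + 1) = u * w ^ (n + 1) := by
  rw [pow_succ, ← mul_assoc, ← (hw.pow_right n).eq, mul_assoc, ← pow_succ]

theorem mul_pow_mul_mul_of_semiconjBy (hv : SemiconjBy u v (u * v)) (n : ℕ) (w : M) :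
    (u * v) ^ n * (u * w) = u * (v ^ n * w) := by
  rw [← mul_assoc, ← (hv.pow_right n).eq, mul_assoc]

theorem semiconjBy_op_one_sub_iff {R : Type*} [Ring R] {u w : R} :
    SemiconjBy (MulOpposite.op (1 - u)) (MulOpposite.op w)
      (MulOpposite.op (1 - u) * MulOpposite.op w) ↔ SemiconjBy u w (u * w) := by
  have hdiff : w * (1 - u) - (1 - u) * (w * (1 - u)) = u * w - u * w * u := by noncomm_ring
  simp only [SemiconjBy, ← MulOpposite.op_mul, MulOpposite.op_inj]
  rw [← sub_eq_zero, hdiff, sub_eq_zero]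

theorem one_sub_mul_mul_one_sub {R : Type*} [Ring R] {u w : R} (hw : SemiconjBy u w (u * w)) :
    (1 - u) * w * (1 - u) = w * (1 - u) := by
  calc (1 - u) * w * (1 - u) = w * (1 - u) - (u * w - u * w * u) := by noncomm_ring
    _ = w * (1 - u) := by rw [← hw.eq, sub_self, sub_zero]

theorem mul_one_sub_add_mul_add {R : Type*} [Ring R] {u w : R} (hw : SemiconjBy u w (u * w)) :
    w * (1 - u) + u * w + (1 - u) * w * u = w := by
  calc w * (1 - u) + u * w + (1 - u) * w * u = w + (u * w - u * w * u) := by noncomm_ring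
    _ = w := by rw [← hw.eq, sub_self, add_zero]

end Compression

theorem norm_mul_pow_le {A : Type*} [SeminormedRing A] (c x : A) (n : ℕ) :
    ‖c * x ^ n‖ ≤ ‖c‖ * ‖x‖ ^ n := by
  induction n with
  | zero => simp only [pow_zero, mul_one, le_refl]
  | succ n ih =>
    rw [pow_succ, pow_succ, ← mul_assoc, ← mul_assoc]
    exact norm_mul_le_of_le ih le_rfl

theorem norm_pow_mul_le {A : Type*} [SeminormedRing A] (x c : A) (n : ℕ) :
    ‖x ^ n * c‖ ≤ ‖x‖ ^ n * ‖c‖ := by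
  induction n with
  | zero => simp only [pow_zero, one_mul, le_refl]
  | succ n ih =>
    rw [pow_succ', pow_succ', mul_assoc, mul_assoc]
    exact norm_mul_le_of_le le_rfl ih

section Quasinilpotent

variable {A : Type*} [NormedRing A] [NormedAlgebra ℂ A]

theorem isQuasinilpotent_iff_forall_mem_spectrum {a : A} :
    IsQuasinilpotent a ↔ ∀ l ∈ spectrum ℂ a, l = 0 := by
  simp [IsQuasinilpotent, spectralRadius]

theorem isQuasinilpotent_iff_isUnit {a : A} :
    IsQuasinilpotent a ↔ ∀ l : ℂ, l ≠ 0 → IsUnit (algebraMap ℂ A l - a) := by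
  rw [isQuasinilpotent_iff_forall_mem_spectrum]
  exact forall_congr' fun l => by rw [spectrum.mem_iff, ← not_imp_not, not_not]

theorem isQuasinilpotent_mul_comm {a b : A} :
    IsQuasinilpotent (a * b) ↔ IsQuasinilpotent (b * a) := by
  simp only [isQuasinilpotent_iff_forall_mem_spectrum]
  refine forall_congr' fun l => ?_
  obtain rfl | hl := eq_or_ne l 0
  · simp only [implies_true]
  · rw [show l ∈ spectrum ℂ (a * b) ↔ l ∈ spectrum ℂ (b * a) from
      spectrum.unit_mem_mul_comm (r := Units.mk0 l hl)]

theorem isQuasinilpotent_op {a : A} :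
    IsQuasinilpotent (MulOpposite.op a) ↔ IsQuasinilpotent a := by
  simp only [isQuasinilpotent_iff_isUnit, MulOpposite.algebraMap_apply, ← MulOpposite.op_sub,
    isUnit_op]

namespace IsQuasinilpotent

theorem add_of_mul_eq_zero {r s : A} (hr : IsQuasinilpotent r) (hs : IsQuasinilpotent s)
    (h : r * s = 0) : IsQuasinilpotent (r + s) := by
  rw [isQuasinilpotent_iff_isUnit] at hr hs ⊢
  intro l hl
  have hprod : (algebraMap ℂ A l - r) * (algebraMap ℂ A l - s)
      = algebraMap ℂ A l * (algebraMap ℂ A l - (r + s)) := by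
    rw [sub_mul, mul_sub r, h, ← Algebra.commutes l r]
    noncomm_ring
  obtain ⟨u, hu⟩ : IsUnit (algebraMap ℂ A l) := (IsUnit.mk0 l hl).map _
  have hunit := (hr l hl).mul (hs l hl)
  rw [hprod, ← hu, Units.isUnit_units_mul] at hunit
  rwa [← hu]

theorem of_isNilpotent {a : A} (h : IsNilpotent a) : IsQuasinilpotent a :=
  isQuasinilpotent_iff_isUnit.2 fun l hl => sub_eq_add_neg (algebraMap ℂ A l) a ▸
    h.neg.isUnit_add_left_of_commute ((IsUnit.mk0 l hl).map _) (Algebra.commutes l (-a)).symm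

variable [CompleteSpace A]

theorem exists_norm_pow_le {a : A} (ha : IsQuasinilpotent a) {ε : ℝ} (hε : 0 < ε) :
    ∃ C > 0, ∀ n : ℕ, ‖a ^ n‖ ≤ C * ε ^ n := by
  have hlim := spectrum.pow_norm_pow_one_div_tendsto_nhds_spectralRadius a
  rw [show spectralRadius ℂ a = 0 from ha] at hlim
  have hO : (fun n : ℕ => a ^ n) =O[Filter.atTop] (fun n : ℕ => ε ^ n) := by
    refine Asymptotics.IsBigO.of_bound 1 ?_
    filter_upwards [hlim.eventually (gt_mem_nhds (ENNReal.ofReal_pos.2 hε)),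
      Filter.eventually_ge_atTop 1] with n hn h1
    have hroot : ‖a ^ n‖ ^ (1 / n : ℝ) < ε := (ENNReal.ofReal_lt_ofReal_iff hε).1 hn
    have hpow := pow_le_pow_left₀ (by positivity) hroot.le n
    rw [one_div, Real.rpow_inv_natCast_pow (norm_nonneg _) (by omega)] at hpow
    rwa [one_mul, Real.norm_of_nonneg (by positivity)]
  obtain ⟨C, hC, h⟩ := Asymptotics.bound_of_isBigO_nat_atTop hO
  refine ⟨C, hC, fun n => ?_⟩
  calc ‖a ^ n‖ ≤ C * ‖ε ^ n‖ := h (pow_pos hε n).ne'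
    _ = C * ε ^ n := by rw [norm_pow, Real.norm_of_nonneg hε.le]

theorem of_forall_exists_norm_pow_le {a : A}
    (h : ∀ ε : ℝ, 0 < ε → ∃ C : ℝ, ∀ n : ℕ, ‖a ^ n‖ ≤ C * ε ^ n) : IsQuasinilpotent a := by
  rw [isQuasinilpotent_iff_forall_mem_spectrum]
  intro l hl
  by_contra hl0
  have _ : 0 < ‖l‖ := norm_pos_iff.2 hl0
  obtain ⟨C, hC⟩ := h (‖l‖ / 2) (by positivity)
  have hbound (n : ℕ) : (2 : ℝ) ^ n ≤ C * ‖(1 : A)‖ := by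
    refine le_of_mul_le_mul_right ?_ (show 0 < (‖l‖ / 2) ^ n by positivity)
    calc 2 ^ n * (‖l‖ / 2) ^ n = ‖l ^ n‖ := by
          rw [← mul_pow, mul_div_cancel₀ _ two_ne_zero, norm_pow]
      _ ≤ ‖a ^ n‖ * ‖(1 : A)‖ := spectrum.norm_le_norm_mul_of_mem (spectrum.pow_mem_pow a n hl)
      _ ≤ C * (‖l‖ / 2) ^ n * ‖(1 : A)‖ := by gcongr; exact hC n
      _ = C * ‖(1 : A)‖ * (‖l‖ / 2) ^ n := by ring
  obtain ⟨n, hn⟩ := pow_unbounded_of_one_lt (C * ‖(1 : A)‖) one_lt_two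
  exact (hbound n).not_gt hn

theorem add_of_commute {r s : A} (hr : IsQuasinilpotent r) (hs : IsQuasinilpotent s)
    (h : Commute r s) : IsQuasinilpotent (r + s) := by
  refine of_forall_exists_norm_pow_le fun ε hε => ?_
  obtain ⟨C, _, hCr⟩ := hr.exists_norm_pow_le (half_pos hε)
  obtain ⟨D, _, hDs⟩ := hs.exists_norm_pow_le (half_pos hε)
  refine ⟨C * D, fun n => ?_⟩
  have hbinom : ε ^ n =
      ∑ m ∈ Finset.range (n + 1), (ε / 2) ^ m * (ε / 2) ^ (n - m) * (n.choose m : ℝ) := by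
    rw [← add_pow, add_halves]
  rw [h.add_pow, hbinom, Finset.mul_sum]
  refine norm_sum_le_of_le _ fun m _ => ?_
  rw [← Nat.cast_comm, ← nsmul_eq_mul]
  calc ‖n.choose m • (r ^ m * s ^ (n - m))‖
      ≤ n.choose m * ((C * (ε / 2) ^ m) * (D * (ε / 2) ^ (n - m))) :=
        norm_nsmul_le.trans (by gcongr; exact norm_mul_le_of_le (hCr m) (hDs _))
    _ = C * D * ((ε / 2) ^ m * (ε / 2) ^ (n - m) * n.choose m) := by ring

theorem of_semiconjBy {u w : A} (hw : IsQuasinilpotent w) (h : SemiconjBy u w (u * w)) :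
    IsQuasinilpotent (u * w) := by
  refine of_forall_exists_norm_pow_le fun ε hε => ?_
  obtain ⟨C, _, hCw⟩ := hw.exists_norm_pow_le hε
  refine ⟨max ‖(1 : A)‖ (‖u‖ * C), fun n => ?_⟩
  obtain _ | n := n
  · simp only [pow_zero, mul_one, le_max_left]
  · rw [mul_pow_succ_of_semiconjBy h]
    calc ‖u * w ^ (n + 1)‖ ≤ ‖u‖ * (C * ε ^ (n + 1)) := norm_mul_le_of_le le_rfl (hCw _)
      _ ≤ max ‖(1 : A)‖ (‖u‖ * C) * ε ^ (n + 1) := by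
        rw [← mul_assoc]; gcongr; exact le_max_right _ _

theorem summable_norm_pow_mul_pow {a : A} (ha : IsQuasinilpotent a) {K : ℝ} (hK : 0 ≤ K) :
    Summable fun n : ℕ => ‖a ^ n‖ * K ^ n := by
  obtain ⟨C, -, hC⟩ := ha.exists_norm_pow_le (show 0 < 1 / (2 * (K + 1)) by positivity)
  refine Summable.of_nonneg_of_le (fun n => by positivity) (fun n => ?_)
    (summable_geometric_two.mul_left C)
  calc ‖a ^ n‖ * K ^ n ≤ C * (1 / (2 * (K + 1))) ^ n * (K + 1) ^ n := by
        gcongr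
        · exact (norm_nonneg _).trans (hC n)
        · exact hC n
        · exact (lt_add_one K).le
    _ = C * (1 / 2) ^ n := by
        rw [mul_assoc, ← mul_pow]
        congr 2
        field_simp

theorem eq_zero_of_mul_mul_eq {r t x : A} (hr : IsQuasinilpotent r) (h : r * t * x = t) :
    t = 0 := by
  have hiter (n : ℕ) : r ^ n * t * x ^ n = t := by
    induction n with
    | zero => simp only [pow_zero, one_mul, mul_one]
    | succ n ih =>
      calc r ^ (n + 1) * t * x ^ (n + 1) = r ^ n * (r * t * x) * x ^ n := by
            simp only [pow_succ r, pow_succ' x, mul_assoc]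
        _ = t := by rw [h, ih]
  have hlim := (hr.summable_norm_pow_mul_pow (norm_nonneg x)).tendsto_atTop_zero.mul_const ‖t‖
  rw [zero_mul] at hlim
  refine norm_le_zero_iff.1 (ge_of_tendsto' hlim fun n => ?_)
  calc ‖t‖ = ‖r ^ n * t * x ^ n‖ := by rw [hiter]
    _ ≤ ‖r ^ n‖ * ‖t‖ * ‖x‖ ^ n :=
      (norm_mul_pow_le _ _ _).trans (by gcongr; exact norm_mul_le _ _)
    _ = ‖r ^ n‖ * ‖x‖ ^ n * ‖t‖ := by ring

theorem eq_zero_of_mul_mul_eq' {r t x : A} (hr : IsQuasinilpotent r) (h : x * t * r = t) :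
    t = 0 := by
  refine MulOpposite.op_eq_zero_iff t |>.1 <|
    (isQuasinilpotent_op.2 hr).eq_zero_of_mul_mul_eq (x := MulOpposite.op x) ?_
  rw [mul_assoc, ← MulOpposite.op_mul, ← MulOpposite.op_mul, h]

theorem summable_pow_mul_mul_pow {q : A} (hq : IsQuasinilpotent q) (c x : A) :
    Summable fun n : ℕ => q ^ n * c * x ^ n := by
  refine Summable.of_norm_bounded
    ((hq.summable_norm_pow_mul_pow (norm_nonneg x)).mul_right ‖c‖) fun n => ?_
  calc ‖q ^ n * c * x ^ n‖ ≤ ‖q ^ n‖ * ‖c‖ * ‖x‖ ^ n :=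
        (norm_mul_pow_le _ _ _).trans (by gcongr; exact norm_mul_le _ _)
    _ = ‖q ^ n‖ * ‖x‖ ^ n * ‖c‖ := by ring

theorem summable_pow_mul_pow_mul_pow_add {q r : A} (hq : IsQuasinilpotent q)
    (hr : IsQuasinilpotent r) (c d x : A) :
    Summable fun n : ℕ × ℕ => q ^ n.1 * c * r ^ n.2 * d * x ^ (n.1 + n.2) := by
  have hprod := (hq.summable_norm_pow_mul_pow (norm_nonneg x)).mul_of_nonneg
    (hr.summable_norm_pow_mul_pow (norm_nonneg x))
    (fun _ => by positivity) (fun _ => by positivity)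
  refine Summable.of_norm_bounded (hprod.mul_right (‖c‖ * ‖d‖)) fun ⟨n, k⟩ => ?_
  calc ‖q ^ n * c * r ^ k * d * x ^ (n + k)‖
      ≤ ‖q ^ n‖ * ‖c‖ * ‖r ^ k‖ * ‖d‖ * ‖x‖ ^ (n + k) :=
        (norm_mul_pow_le _ _ _).trans <| by
          gcongr
          exact norm_mul_le_of_le (norm_mul_le_of_le (norm_mul_le _ _) le_rfl) le_rfl
    _ = ‖q ^ n‖ * ‖x‖ ^ n * (‖r ^ k‖ * ‖x‖ ^ k) * (‖c‖ * ‖d‖) := by ring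

theorem summable_pow_mul_pow_add_mul_pow {q : A} (hq : IsQuasinilpotent q) (x c d y : A) :
    Summable fun n : ℕ × ℕ => x ^ n.1 * c * q ^ (n.1 + n.2) * d * y ^ n.2 := by
  set K : ℝ := ‖x‖ + ‖y‖ + 1
  have hxK : ‖x‖ ≤ K := by linarith [norm_nonneg y]
  have hyK : ‖y‖ ≤ K := by linarith [norm_nonneg x]
  have hKpos : 0 < K := by positivity
  obtain ⟨C, -, hC⟩ := hq.exists_norm_pow_le (show 0 < 1 / (2 * K) by positivity)
  have hgeom : Summable fun n : ℕ × ℕ => (1 / 2 : ℝ) ^ n.1 * (1 / 2) ^ n.2 :=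
    summable_geometric_two.mul_of_nonneg summable_geometric_two
      (fun _ => by positivity) (fun _ => by positivity)
  refine Summable.of_norm_bounded (hgeom.mul_left (‖c‖ * ‖d‖ * C)) fun ⟨n, k⟩ => ?_
  calc ‖x ^ n * c * q ^ (n + k) * d * y ^ k‖
      ≤ ‖x‖ ^ n * ‖c‖ * ‖q ^ (n + k)‖ * ‖d‖ * ‖y‖ ^ k :=
        (norm_mul_pow_le _ _ _).trans <| by
          gcongr
          exact norm_mul_le_of_le
            (norm_mul_le_of_le (norm_pow_mul_le _ _ _) le_rfl) le_rfl
    _ ≤ K ^ n * ‖c‖ * (C * (1 / (2 * K)) ^ (n + k)) * ‖d‖ * K ^ k := by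
        have hCpos : 0 ≤ C * (1 / (2 * K)) ^ (n + k) := (norm_nonneg _).trans (hC _)
        gcongr
        exact hC _
    _ = ‖c‖ * ‖d‖ * C * ((1 / (2 * K) * K) ^ n * (1 / (2 * K) * K) ^ k) := by
        rw [mul_pow, mul_pow, pow_add]
        ring
    _ = ‖c‖ * ‖d‖ * C * ((1 / 2) ^ n * (1 / 2) ^ k) := by
        rw [one_div_mul_eq_div, div_mul_cancel_right₀ hKpos.ne', one_div]

end IsQuasinilpotent

end Quasinilpotent

theorem isGDrazinInverse_op {A : Type*} [NormedRing A] [NormedAlgebra ℂ A] {a x : A} :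
    IsGDrazinInverse (MulOpposite.op a) (MulOpposite.op x) ↔ IsGDrazinInverse a x := by
  have hquasi (hcomm : Commute a x) : MulOpposite.op a - MulOpposite.op a ^ 2 * MulOpposite.op x
      = MulOpposite.op (a - a ^ 2 * x) := by
    rw [← MulOpposite.op_pow, ← MulOpposite.op_mul, ← MulOpposite.op_sub, (hcomm.pow_left 2).eq]
  constructor
  · intro h
    have hcomm : a * x = x * a := (MulOpposite.op_injective h.comm).symm
    exact ⟨(mul_assoc x a x).trans (MulOpposite.op_injective h.outer), hcomm,
      isQuasinilpotent_op.1 (hquasi hcomm ▸ h.quasinil)⟩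
  · intro h
    exact ⟨congrArg MulOpposite.op ((mul_assoc x a x).symm.trans h.outer),
      congrArg MulOpposite.op h.comm.symm,
      hquasi h.comm ▸ isQuasinilpotent_op.2 h.quasinil⟩

namespace IsGDrazinInverse

variable {A : Type*} [NormedRing A] [NormedAlgebra ℂ A] {a x t : A}

theorem isIdempotentElem (h : IsGDrazinInverse a x) : IsIdempotentElem (a * x) := by
  rw [IsIdempotentElem, mul_assoc, ← mul_assoc x, h.outer]

theorem inverse_mul_mul_self (h : IsGDrazinInverse a x) : x * (a * x) = x := by
  rw [← mul_assoc, h.outer]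

theorem mul_inverse_mul_self (h : IsGDrazinInverse a x) : a * x * x = x := by
  rw [h.comm, h.outer]

theorem inverse_pow_mul_self (h : IsGDrazinInverse a x) (n : ℕ) :
    x ^ (n + 2) * a = x ^ (n + 1) := by
  rw [pow_succ, pow_succ, mul_assoc, mul_assoc, ← h.comm, h.inverse_mul_mul_self]

theorem inverse_mul_one_sub (h : IsGDrazinInverse a x) : x * (1 - a * x) = 0 := by
  rw [mul_sub, mul_one, h.inverse_mul_mul_self, sub_self]

theorem one_sub_mul_inverse (h : IsGDrazinInverse a x) : (1 - a * x) * x = 0 := by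
  rw [sub_mul, one_mul, h.mul_inverse_mul_self, sub_self]

theorem commute_one_sub (h : IsGDrazinInverse a x) : Commute a (1 - a * x) :=
  (Commute.one_right a).sub_right ((Commute.refl a).mul_right h.comm)

theorem mul_inverse_eq_zero (h : IsGDrazinInverse a x) (ht : t * a = 0) : t * x = 0 := by
  rw [← h.mul_inverse_mul_self, ← mul_assoc, ← mul_assoc, ht, zero_mul, zero_mul]

theorem inverse_mul_eq_zero (h : IsGDrazinInverse a x) (ht : a * t = 0) : x * t = 0 := by
  rw [← h.outer, mul_assoc x, h.comm, mul_assoc, mul_assoc, ht, mul_zero, mul_zero]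

theorem isQuasinilpotent_mul_one_sub (h : IsGDrazinInverse a x) :
    IsQuasinilpotent (a * (1 - a * x)) := by
  rw [mul_sub, mul_one, ← mul_assoc, ← pow_two]
  exact h.quasinil

theorem of_isQuasinilpotent_mul_one_sub (houter : x * a * x = x) (hcomm : a * x = x * a)
    (hquasi : IsQuasinilpotent (a * (1 - a * x))) : IsGDrazinInverse a x :=
  ⟨houter, hcomm, by rwa [mul_sub, mul_one, ← mul_assoc, ← pow_two] at hquasi⟩

theorem cline {x y w : A} (h : IsGDrazinInverse (x * y) w) :
    IsGDrazinInverse (y * x) (y * w ^ 2 * x) := by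
  have hmul : y * x * (y * w ^ 2 * x) = y * w * x := by
    calc y * x * (y * w ^ 2 * x) = y * (x * y * w * w) * x := by noncomm_ring
      _ = y * w * x := by rw [h.mul_inverse_mul_self]
  refine of_isQuasinilpotent_mul_one_sub ?_ ?_ ?_
  · calc y * w ^ 2 * x * (y * x) * (y * w ^ 2 * x)
        = y * w * (w * (x * y) * (x * y * w * w)) * x := by noncomm_ring
      _ = y * w ^ 2 * x := by
        rw [h.mul_inverse_mul_self, h.outer, pow_two, mul_assoc y]
  · calc y * x * (y * w ^ 2 * x) = y * w * x := hmul
      _ = y * (w * (w * (x * y))) * x := by rw [← h.comm, h.inverse_mul_mul_self]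
      _ = y * w ^ 2 * x * (y * x) := by noncomm_ring
  · rw [hmul, show y * x * (1 - y * w * x) = y * ((1 - x * y * w) * x) by noncomm_ring,
      isQuasinilpotent_mul_comm, mul_assoc, ← h.commute_one_sub.eq]
    exact h.isQuasinilpotent_mul_one_sub

variable [CompleteSpace A] {y w Y W u : A}

theorem semiconjBy (hw : IsGDrazinInverse w W) (hy : IsGDrazinInverse y Y)
    (h : SemiconjBy u w y) : SemiconjBy u W Y := by
  have hleft : (1 - y * Y) * (u * W) = 0 := by
    refine hy.isQuasinilpotent_mul_one_sub.eq_zero_of_mul_mul_eq (x := W) ?_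
    calc y * (1 - y * Y) * ((1 - y * Y) * (u * W)) * W
        = y * ((1 - y * Y) * (1 - y * Y)) * (u * (W * W)) := by simp only [mul_assoc]
      _ = (1 - y * Y) * (u * w) * (W * W) := by
        rw [hy.isIdempotentElem.one_sub.eq, hy.commute_one_sub.eq, mul_assoc _ y, ← mul_assoc y,
          ← h.eq, ← mul_assoc]
      _ = (1 - y * Y) * (u * (w * W * W)) := by simp only [mul_assoc]
      _ = (1 - y * Y) * (u * W) := by rw [hw.mul_inverse_mul_self]
  have hright : Y * u * (1 - w * W) = 0 := by
    refine hw.isQuasinilpotent_mul_one_sub.eq_zero_of_mul_mul_eq' (x := Y) ?_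
    calc Y * (Y * u * (1 - w * W)) * (w * (1 - w * W))
        = Y * Y * u * ((1 - w * W) * (1 - w * W) * w) := by
          simp only [mul_assoc, hw.commute_one_sub.eq]
      _ = Y * Y * (u * w) * (1 - w * W) := by
        rw [hw.isIdempotentElem.one_sub.eq, ← hw.commute_one_sub.eq]
        simp only [mul_assoc]
      _ = Y * (Y * y) * u * (1 - w * W) := by
        rw [h.eq]
        simp only [mul_assoc]
      _ = Y * u * (1 - w * W) := by rw [← hy.comm, hy.inverse_mul_mul_self]
  rw [sub_mul, one_mul, sub_eq_zero] at hleft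
  rw [mul_sub, mul_one, sub_eq_zero] at hright
  calc u * W = Y * (y * u) * W := by rw [hleft, hy.comm]; simp only [mul_assoc]
    _ = Y * u * (w * W) := by rw [← h.eq]; simp only [mul_assoc]
    _ = Y * u := hright.symm

theorem mul_left (hw : IsGDrazinInverse w W) (huw : SemiconjBy u w (u * w))
    (huW : SemiconjBy u W (u * W)) : IsGDrazinInverse (u * w) (u * W) := by
  have hmul : u * w * (u * W) = u * (w * W) := mul_mul_mul_of_semiconjBy huw W
  refine of_isQuasinilpotent_mul_one_sub ?_ ?_ ?_
  · rw [mul_assoc, hmul, mul_mul_mul_of_semiconjBy huW, hw.inverse_mul_mul_self]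
  · rw [hmul, mul_mul_mul_of_semiconjBy huW, hw.comm]
  · have hcompl : u * w * (1 - u * w * (u * W)) = u * (w * (1 - w * W)) := by
      rw [hmul, mul_sub, mul_mul_mul_of_semiconjBy huw, mul_one, mul_sub w, mul_sub, mul_one]
    rw [hcompl]
    refine hw.isQuasinilpotent_mul_one_sub.of_semiconjBy ?_
    rw [mul_sub, mul_one, mul_sub]
    exact huw.sub_right (semiconjBy_mul_mul huw (semiconjBy_mul_mul huw huW))

theorem mul_right_one_sub (hw : IsGDrazinInverse w W) (huw : SemiconjBy u w (u * w))
    (huW : SemiconjBy u W (u * W)) : IsGDrazinInverse (w * (1 - u)) (W * (1 - u)) :=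
  isGDrazinInverse_op.1 <| (isGDrazinInverse_op.2 hw).mul_left
    (semiconjBy_op_one_sub_iff.2 huw) (semiconjBy_op_one_sub_iff.2 huW)

end IsGDrazinInverse

theorem isGDrazinInvertible_mul_comm {A : Type*} [NormedRing A] [NormedAlgebra ℂ A] {x y : A} :
    IsGDrazinInvertible (x * y) ↔ IsGDrazinInvertible (y * x) :=
  ⟨fun ⟨_, h⟩ => ⟨_, h.cline⟩, fun ⟨_, h⟩ => ⟨_, h.cline⟩⟩

section Corner

variable {A : Type*} [NormedRing A] [NormedAlgebra ℂ A] [CompleteSpace A] {b B p u : A}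

theorem IsGDrazinInverse.semiconjBy_of_isGDrazinInvertible_mul (hb : IsGDrazinInverse b B)
    (hub : SemiconjBy u b (u * b)) (h : IsGDrazinInvertible (u * b)) :
    SemiconjBy u B (u * B) := by
  obtain ⟨Y, hY⟩ := h
  have hYu : u * B = Y * u := hb.semiconjBy hY hub
  have hkill : Y * (1 - u) = 0 :=
    hY.inverse_mul_eq_zero (by rw [mul_sub, mul_one, ← hub.eq, sub_self])
  rw [mul_sub, mul_one, sub_eq_zero] at hkill
  rwa [SemiconjBy, hYu, ← hkill]

theorem IsGDrazinInverse.semiconjBy_of_isGDrazinInvertible_mul_compl (hb : IsGDrazinInverse b B)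
    (hub : SemiconjBy u b (u * b)) (h : IsGDrazinInvertible (b * (1 - u))) :
    SemiconjBy u B (u * B) := by
  obtain ⟨X, hX⟩ := h
  rw [← semiconjBy_op_one_sub_iff] at hub ⊢
  exact (isGDrazinInverse_op.2 hb).semiconjBy_of_isGDrazinInvertible_mul hub
    ⟨_, isGDrazinInverse_op.2 hX⟩

theorem IsGDrazinInverse.semiconjBy_of_corner (hb : IsGDrazinInverse b B)
    (hub : SemiconjBy u b (u * b))
    (hcorner : IsGDrazinInvertible (u * b * u) ∨ IsGDrazinInvertible (u * b) ∨
      IsGDrazinInvertible (b * u) ∨ IsGDrazinInvertible ((1 - u) * b * (1 - u)) ∨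
      IsGDrazinInvertible ((1 - u) * b) ∨ IsGDrazinInvertible (b * (1 - u))) :
    SemiconjBy u B (u * B) := by
  have hcompress : u * b * u = u * b := hub.eq.symm
  rw [hcompress, one_sub_mul_mul_one_sub hub, isGDrazinInvertible_mul_comm (x := b) (y := u),
    isGDrazinInvertible_mul_comm (x := 1 - u)] at hcorner
  rcases hcorner with h | h | h | h | h | h
  exacts [hb.semiconjBy_of_isGDrazinInvertible_mul hub h,
    hb.semiconjBy_of_isGDrazinInvertible_mul hub h, hb.semiconjBy_of_isGDrazinInvertible_mul hub h,
    hb.semiconjBy_of_isGDrazinInvertible_mul_compl hub h,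
    hb.semiconjBy_of_isGDrazinInvertible_mul_compl hub h,
    hb.semiconjBy_of_isGDrazinInvertible_mul_compl hub h]

end Corner

theorem mul_eq_zero_of_hasSum {ι R : Type*} [NonUnitalNonAssocSemiring R] [TopologicalSpace R]
    [IsTopologicalSemiring R] [T2Space R] {f : ι → R} {s t : R} (hf : HasSum f s)
    (h : ∀ i, t * f i = 0) : t * s = 0 :=
  (hf.mul_left t).unique (by simpa only [h] using hasSum_zero)

theorem mul_eq_zero_of_hasSum' {ι R : Type*} [NonUnitalNonAssocSemiring R] [TopologicalSpace R]
    [IsTopologicalSemiring R] [T2Space R] {f : ι → R} {s t : R} (hf : HasSum f s)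
    (h : ∀ i, f i * t = 0) : s * t = 0 :=
  (hf.mul_right t).unique (by simpa only [h] using hasSum_zero)

theorem mul_sylvester_eq_zero {A : Type*} [NormedRing A] {x X z Y R t : A}
    (hR : HasSum (fun n : ℕ => (1 - x * X) * x ^ n * z * Y ^ (n + 2)) R) (hx : t * x = 0)
    (hz : t * z = 0) : t * R = 0 :=
  mul_eq_zero_of_hasSum hR fun n => by
    obtain _ | n := n
    · simp only [pow_zero, mul_one, ← mul_assoc, mul_sub, hx, sub_zero, zero_mul, hz]
    · simp only [pow_succ', ← mul_assoc, mul_sub, mul_one, hx, sub_zero, zero_mul]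

section Sylvester

variable {A : Type*} [NormedRing A] [NormedAlgebra ℂ A] {x X y Y z S R t : A}

open MulOpposite

namespace IsGDrazinInverse

theorem pow_mul_one_sub (hy : IsGDrazinInverse y Y) (n : ℕ) :
    y ^ n * (1 - y * Y) = (y * (1 - y * Y)) ^ n * (1 - y * Y) := by
  rw [hy.commute_one_sub.mul_pow, mul_assoc, ← pow_succ, hy.isIdempotentElem.one_sub.pow_succ_eq]

theorem summable_sylvester [CompleteSpace A] (hx : IsGDrazinInverse x X) (z Y : A) :
    Summable fun n : ℕ => (1 - x * X) * x ^ n * z * Y ^ (n + 2) := by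
  refine ((hx.isQuasinilpotent_mul_one_sub.summable_pow_mul_mul_pow
    ((1 - x * X) * z) Y).mul_right (Y ^ 2)).congr fun n => ?_
  rw [← (hx.commute_one_sub.pow_left n).eq, hx.pow_mul_one_sub, pow_add]
  simp only [mul_assoc]

theorem sylvester_sub_eq (hx : IsGDrazinInverse x X) (hy : IsGDrazinInverse y Y)
    (hR : HasSum (fun n : ℕ => (1 - x * X) * x ^ n * z * Y ^ (n + 2)) R) :
    R * y - x * R = (1 - x * X) * z * Y := by
  have hRy : HasSum (fun n : ℕ => (1 - x * X) * x ^ n * z * Y ^ (n + 1)) (R * y) := by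
    refine (hR.mul_right y).congr_fun fun n => ?_
    rw [mul_assoc _ _ y, hy.inverse_pow_mul_self]
  have hxR : HasSum (fun n : ℕ => (1 - x * X) * x ^ (n + 1) * z * Y ^ (n + 1 + 1)) (x * R) := by
    refine (hR.mul_left x).congr_fun fun n => ?_
    rw [pow_succ' x n, ← mul_assoc (1 - x * X), ← hx.commute_one_sub.eq]
    simp only [mul_assoc]
  rw [hRy.unique (HasSum.zero_add hxR), add_sub_cancel_right]
  simp only [zero_add, pow_one, pow_zero, mul_one]

theorem sylvester_mul_mul (hy : IsGDrazinInverse y Y)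
    (hR : HasSum (fun n : ℕ => (1 - x * X) * x ^ n * z * Y ^ (n + 2)) R) : R * (y * Y) = R := by
  have hterm (n : ℕ) : (1 - x * X) * x ^ n * z * Y ^ (n + 2) * (1 - y * Y) = 0 := by
    rw [pow_succ, mul_assoc, mul_assoc (_ ^ _), hy.inverse_mul_one_sub, mul_zero, mul_zero]
  rw [eq_comm, ← sub_eq_zero, ← mul_one_sub]
  exact mul_eq_zero_of_hasSum' hR hterm

theorem inverse_mul_sylvester (hx : IsGDrazinInverse x X)
    (hR : HasSum (fun n : ℕ => (1 - x * X) * x ^ n * z * Y ^ (n + 2)) R) : X * R = 0 :=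
  mul_eq_zero_of_hasSum hR fun n => by
    simp only [← mul_assoc, hx.inverse_mul_one_sub, zero_mul]

theorem sylvester_op (hy : IsGDrazinInverse y Y)
    (hS : HasSum (fun n : ℕ => X ^ (n + 2) * z * y ^ n * (1 - y * Y)) S) :
    HasSum (fun n : ℕ => (1 - op y * op Y) * op y ^ n * op z * op X ^ (n + 2)) (op S) := by
  simpa only [op_mul, op_sub, op_one, op_pow, hy.comm, mul_assoc] using hS.op

theorem summable_sylvester' [CompleteSpace A] (hy : IsGDrazinInverse y Y) (X z : A) :
    Summable fun n : ℕ => X ^ (n + 2) * z * y ^ n * (1 - y * Y) := by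
  rw [← summable_op]
  simpa only [op_mul, op_sub, op_one, op_pow, hy.comm, mul_assoc] using
    (isGDrazinInverse_op.2 hy).summable_sylvester (op z) (op X)

theorem sylvester_sub_eq' (hx : IsGDrazinInverse x X) (hy : IsGDrazinInverse y Y)
    (hS : HasSum (fun n : ℕ => X ^ (n + 2) * z * y ^ n * (1 - y * Y)) S) :
    x * S - S * y = X * z * (1 - y * Y) := op_injective <| by
  simpa only [op_mul, op_sub, op_one, hy.comm, mul_assoc] using
    (isGDrazinInverse_op.2 hy).sylvester_sub_eq (isGDrazinInverse_op.2 hx) (hy.sylvester_op hS)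

theorem mul_mul_sylvester' (hx : IsGDrazinInverse x X) (hy : IsGDrazinInverse y Y)
    (hS : HasSum (fun n : ℕ => X ^ (n + 2) * z * y ^ n * (1 - y * Y)) S) : x * X * S = S :=
  op_injective <| by
    simpa only [op_mul, hx.comm] using
      (isGDrazinInverse_op.2 hx).sylvester_mul_mul (hy.sylvester_op hS)

theorem sylvester_mul_inverse' (hy : IsGDrazinInverse y Y)
    (hS : HasSum (fun n : ℕ => X ^ (n + 2) * z * y ^ n * (1 - y * Y)) S) : S * Y = 0 :=
  op_injective ((isGDrazinInverse_op.2 hy).inverse_mul_sylvester (hy.sylvester_op hS))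

theorem sylvester_mul_eq_zero' (hy : IsGDrazinInverse y Y)
    (hS : HasSum (fun n : ℕ => X ^ (n + 2) * z * y ^ n * (1 - y * Y)) S) (ht : y * t = 0)
    (hz : z * t = 0) : S * t = 0 :=
  op_injective (mul_sylvester_eq_zero (hy.sylvester_op hS)
    (congrArg op ht) (congrArg op hz))

/- `V = S + R - X * z * Y` is the off-diagonal block of the generalized Drazin inverse of
`x + y + z`: commuting with `x + y + z` amounts to the Sylvester equation
`x * V - V * y = X * z - z * Y`, of which `S` solves the part `X * z * (1 - y * Y)` and `R` the
part `-(1 - x * X) * z * Y`. -/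

theorem mul_offDiag_eq_zero (hx : IsGDrazinInverse x X)
    (hy : IsGDrazinInverse y Y)
    (hS : HasSum (fun n : ℕ => X ^ (n + 2) * z * y ^ n * (1 - y * Y)) S)
    (hR : HasSum (fun n : ℕ => (1 - x * X) * x ^ n * z * Y ^ (n + 2)) R)
    (htx : t * x = 0) (htz : t * z = 0) : t * (S + R - X * z * Y) = 0 := by
  have htX : t * X = 0 := hx.mul_inverse_eq_zero htx
  have htS : t * S = 0 := by
    rw [← hx.mul_mul_sylvester' hy hS, ← mul_assoc, ← mul_assoc, htx, zero_mul, zero_mul]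
  simp only [mul_sub, mul_add, htS, mul_sylvester_eq_zero hR htx htz, ← mul_assoc, htX, zero_mul,
    sub_zero, add_zero]

theorem offDiag_mul_eq_zero (hy : IsGDrazinInverse y Y)
    (hS : HasSum (fun n : ℕ => X ^ (n + 2) * z * y ^ n * (1 - y * Y)) S)
    (hR : HasSum (fun n : ℕ => (1 - x * X) * x ^ n * z * Y ^ (n + 2)) R)
    (hyt : y * t = 0) (hzt : z * t = 0) : (S + R - X * z * Y) * t = 0 := by
  have hYt : Y * t = 0 := hy.inverse_mul_eq_zero hyt
  have hRt : R * t = 0 := by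
    rw [← hy.sylvester_mul_mul hR, mul_assoc, mul_assoc, hYt, mul_zero, mul_zero]
  simp only [sub_mul, add_mul, hy.sylvester_mul_eq_zero' hS hyt hzt, hRt, mul_assoc, hYt,
    mul_zero, sub_zero, add_zero]

theorem offDiag_intertwine (hx : IsGDrazinInverse x X)
    (hy : IsGDrazinInverse y Y)
    (hS : HasSum (fun n : ℕ => X ^ (n + 2) * z * y ^ n * (1 - y * Y)) S)
    (hR : HasSum (fun n : ℕ => (1 - x * X) * x ^ n * z * Y ^ (n + 2)) R) :
    x * (S + R - X * z * Y) + z * Y = (S + R - X * z * Y) * y + X * z := by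
  rw [← sub_eq_zero]
  calc x * (S + R - X * z * Y) + z * Y - ((S + R - X * z * Y) * y + X * z)
      = (x * S - S * y) - (R * y - x * R) - x * X * z * Y + z * Y + X * z * (Y * y) - X * z := by
        noncomm_ring
    _ = 0 := by
        rw [hx.sylvester_sub_eq hy hR, hx.sylvester_sub_eq' hy hS, ← hy.comm]
        noncomm_ring

theorem offDiag_outer (hx : IsGDrazinInverse x X)
    (hy : IsGDrazinInverse y Y)
    (hS : HasSum (fun n : ℕ => X ^ (n + 2) * z * y ^ n * (1 - y * Y)) S)
    (hR : HasSum (fun n : ℕ => (1 - x * X) * x ^ n * z * Y ^ (n + 2)) R) :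
    X * (x * (S + R - X * z * Y) + z * Y) + (S + R - X * z * Y) * (y * Y)
      = S + R - X * z * Y := by
  have hxS : X * (x * S) = S := by
    rw [← mul_assoc, ← hx.comm, hx.mul_mul_sylvester' hy hS]
  calc X * (x * (S + R - X * z * Y) + z * Y) + (S + R - X * z * Y) * (y * Y)
      = X * (x * S) + X * x * R + R * (y * Y) - X * (x * X) * z * Y + S * (y * Y)
        + X * z * Y - X * z * (Y * (y * Y)) := by
        noncomm_ring
    _ = S + R - X * z * Y := by
      rw [hxS, ← hx.comm, mul_assoc x, hx.inverse_mul_sylvester hR, hy.sylvester_mul_mul hR,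
        hx.inverse_mul_mul_self, hy.comm, ← mul_assoc S, hy.sylvester_mul_inverse' hS, ← hy.comm,
        hy.inverse_mul_mul_self]
      noncomm_ring

end IsGDrazinInverse

end Sylvester

/-- `x + y + z` is the decomposition of a block triangular element into its two diagonal blocks
`x`, `y` and its off-diagonal block `z`, expressed by the products that have to vanish, so that no
idempotent has to be named. -/
structure IsBlockTriangular {R : Type*} [Ring R] (x y z : R) : Prop where
  left_mul_right : x * y = 0
  right_mul_left : y * x = 0
  off_mul_left : z * x = 0
  right_mul_off : y * z = 0
  off_mul_off : z * z = 0

namespace IsBlockTriangular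

theorem of_semiconjBy {R : Type*} [Ring R] {u w : R} (hu : IsIdempotentElem u)
    (hw : SemiconjBy u w (u * w)) :
    IsBlockTriangular (w * (1 - u)) (u * w) ((1 - u) * w * u) := by
  have hzero {v : R} (hv : SemiconjBy u v (u * v)) : u * v * (1 - u) = 0 := by
    rw [mul_sub, mul_one, sub_eq_zero]
    exact hv.eq
  exact {
    left_mul_right := by
      rw [mul_assoc, ← mul_assoc _ u, hu.one_sub_mul_self, zero_mul, mul_zero]
    right_mul_left := by
      rw [← mul_assoc, mul_assoc u, hzero (semiconjBy_mul_mul hw hw)]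
    off_mul_left := by
      rw [← mul_assoc, mul_assoc _ u, mul_assoc _ _ (1 - u), hzero hw, mul_zero]
    right_mul_off := by rw [← mul_assoc, ← mul_assoc, hzero hw, zero_mul, zero_mul]
    off_mul_off := by
      rw [← mul_assoc, ← mul_assoc, mul_assoc _ u, hu.mul_one_sub_self, mul_zero, zero_mul,
        zero_mul] }

variable {A : Type*} [NormedRing A] [NormedAlgebra ℂ A] {x y z X Y S R V : A}

theorem isQuasinilpotent (h : IsBlockTriangular x y z) (hx : IsQuasinilpotent x)
    (hy : IsQuasinilpotent y) : IsQuasinilpotent (x + y + z) := by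
  have hzx : IsQuasinilpotent (z + x) :=
    (IsQuasinilpotent.of_isNilpotent ⟨2, by rw [pow_two, h.off_mul_off]⟩).add_of_mul_eq_zero hx
      h.off_mul_left
  rw [add_comm x, add_assoc, add_comm x]
  exact hy.add_of_mul_eq_zero hzx (by rw [mul_add, h.right_mul_off, h.right_mul_left, add_zero])

theorem mul_one_sub (h : IsBlockTriangular x y z) (hx : IsGDrazinInverse x X)
    (hy : IsGDrazinInverse y Y) (hV : IsBlockTriangular x y V) (hVz : V * z = 0) :
    IsBlockTriangular (x * (1 - x * X)) (y * (1 - y * Y))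
      (z * (1 - y * Y) - x * (x * V + z * Y)) := by
  set c := z * (1 - y * Y) - x * (x * V + z * Y) with hc
  have hleft {t : A} (htx : t * x = 0) (htz : t * z = 0) : t * c = 0 := by
    rw [hc, mul_sub, ← mul_assoc, htz, ← mul_assoc, htx, zero_mul, zero_mul, sub_zero]
  have hyc : y * c = 0 := hleft h.right_mul_left h.right_mul_off
  have hzc : z * c = 0 := hleft h.off_mul_left h.off_mul_off
  have hVc : V * c = 0 := hleft hV.off_mul_left hVz
  have hcx : c * x = 0 := by
    simp only [hc, sub_mul, mul_sub, add_mul, mul_assoc, mul_one, h.off_mul_left,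
      hy.inverse_mul_eq_zero h.right_mul_left, hV.off_mul_left, mul_zero, sub_zero, add_zero]
  have hcc : c * c = 0 := by
    nth_rw 1 [hc]
    simp only [sub_mul, mul_sub, add_mul, mul_assoc, mul_one, hzc, hVc,
      hy.inverse_mul_eq_zero hyc, mul_zero, sub_zero, add_zero]
  exact {
    left_mul_right := by
      rw [hx.commute_one_sub.eq, mul_assoc, ← mul_assoc x, h.left_mul_right, zero_mul, mul_zero]
    right_mul_left := by
      rw [hy.commute_one_sub.eq, mul_assoc, ← mul_assoc y, h.right_mul_left, zero_mul, mul_zero]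
    off_mul_left := by rw [← mul_assoc, hcx, zero_mul]
    right_mul_off := by rw [hy.commute_one_sub.eq, mul_assoc, hyc, mul_zero]
    off_mul_off := hcc }

theorem isGDrazinInverse_of_off (h : IsBlockTriangular x y z) (hx : IsGDrazinInverse x X)
    (hy : IsGDrazinInverse y Y) (hV : IsBlockTriangular x y V) (hzV : z * V = 0) (hVz : V * z = 0)
    (hcomm : x * V + z * Y = V * y + X * z) (houter : X * (x * V + z * Y) + V * (y * Y) = V) :
    IsGDrazinInverse (x + y + z) (X + Y + V) := by
  have hyX : y * X = 0 := hx.mul_inverse_eq_zero h.right_mul_left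
  have hzX : z * X = 0 := hx.mul_inverse_eq_zero h.off_mul_left
  have hxY : x * Y = 0 := hy.mul_inverse_eq_zero h.left_mul_right
  have hYx : Y * x = 0 := hy.inverse_mul_eq_zero h.right_mul_left
  have hXy : X * y = 0 := hx.inverse_mul_eq_zero h.left_mul_right
  have hYz : Y * z = 0 := hy.inverse_mul_eq_zero h.right_mul_off
  have hmul : (x + y + z) * (X + Y + V) = x * X + y * Y + (x * V + z * Y) := by
    simp only [add_mul, mul_add, hyX, hzX, hxY, hV.right_mul_off, hzV]
    abel
  have hmul' : (X + Y + V) * (x + y + z) = x * X + y * Y + (V * y + X * z) := by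
    simp only [add_mul, mul_add, hYx, hV.off_mul_left, hXy, hYz, hVz, hx.comm, hy.comm]
    abel
  refine .of_isQuasinilpotent_mul_one_sub ?_ (by rw [hmul, hmul', hcomm]) ?_
  · rw [mul_assoc, hmul]
    calc (X + Y + V) * (x * X + y * Y + (x * V + z * Y))
        = X * (x * X) + Y * (y * Y) + (X * (x * V + z * Y) + V * (y * Y)) := by
          simp only [add_mul, mul_add, ← mul_assoc, hXy, hYx, hYz, hVz, hV.off_mul_left, zero_mul]
          abel
      _ = X + Y + V := by rw [hx.inverse_mul_mul_self, hy.inverse_mul_mul_self, houter]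
  · have hsplit : (x + y + z) * (1 - (x * X + y * Y + (x * V + z * Y)))
        = x * (1 - x * X) + y * (1 - y * Y) + (z * (1 - y * Y) - x * (x * V + z * Y)) := by
      simp only [add_mul, mul_add, mul_sub, mul_one, ← mul_assoc, h.left_mul_right,
        h.right_mul_left, h.right_mul_off, h.off_mul_left, h.off_mul_off, zero_mul]
      abel
    rw [hmul, hsplit]
    exact (h.mul_one_sub hx hy hV hVz).isQuasinilpotent hx.isQuasinilpotent_mul_one_sub
      hy.isQuasinilpotent_mul_one_sub

theorem isGDrazinInverse_add (h : IsBlockTriangular x y z) (hx : IsGDrazinInverse x X)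
    (hy : IsGDrazinInverse y Y)
    (hS : HasSum (fun n : ℕ => X ^ (n + 2) * z * y ^ n * (1 - y * Y)) S)
    (hR : HasSum (fun n : ℕ => (1 - x * X) * x ^ n * z * Y ^ (n + 2)) R) :
    IsGDrazinInverse (x + y + z) (X + Y + (S + R - X * z * Y)) := by
  have hleft (t : A) (htx : t * x = 0) (htz : t * z = 0) : t * (S + R - X * z * Y) = 0 :=
    hx.mul_offDiag_eq_zero hy hS hR htx htz
  have hright (t : A) (hyt : y * t = 0) (hzt : z * t = 0) : (S + R - X * z * Y) * t = 0 :=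
    hy.offDiag_mul_eq_zero hS hR hyt hzt
  have hyV := hleft y h.right_mul_left h.right_mul_off
  have hzV := hleft z h.off_mul_left h.off_mul_off
  have hV : IsBlockTriangular x y (S + R - X * z * Y) :=
    { h with
      off_mul_left := hright x h.right_mul_left h.off_mul_left
      right_mul_off := hyV
      off_mul_off := hright _ hyV hzV }
  exact h.isGDrazinInverse_of_off hx hy hV hzV (hright z h.right_mul_off h.off_mul_off)
    (hx.offDiag_intertwine hy hS hR) (hx.offDiag_outer hy hS hR)

end IsBlockTriangular

/-- The paper's hypothesis in the case `a^π = 1`: `a` is a quasinilpotent perturbation of `b`, whose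
generalized Drazin inverse is `B`. -/
structure IsQuasinilpotentPerturbation {A : Type*} [NormedRing A] [NormedAlgebra ℂ A]
    (a b B : A) : Prop where
  quasinil : IsQuasinilpotent a
  isGDrazinInverse : IsGDrazinInverse b B
  mul_eq : b * a = (1 - b * B) * a * b * (1 - b * B)

namespace IsQuasinilpotentPerturbation

variable {A : Type*} [NormedRing A] [NormedAlgebra ℂ A] {a b B T : A}

theorem inverse_mul_eq_zero (h : IsQuasinilpotentPerturbation a b B) : B * a = 0 := by
  have hB : B * (b * a) = 0 := by
    simp only [h.mul_eq, ← mul_assoc, h.isGDrazinInverse.inverse_mul_one_sub, zero_mul]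
  rw [← h.isGDrazinInverse.inverse_mul_mul_self, h.isGDrazinInverse.comm, mul_assoc, mul_assoc, hB,
    mul_zero]

theorem one_sub_mul (h : IsQuasinilpotentPerturbation a b B) : (1 - b * B) * a = a := by
  rw [sub_mul, one_mul, mul_assoc, h.inverse_mul_eq_zero, mul_zero, sub_zero]

theorem mul_mul_pow_mul_inverse (h : IsQuasinilpotentPerturbation a b B) (k : ℕ) :
    b * (a ^ (k + 1) * B) = 0 := by
  induction k with
  | zero =>
    rw [zero_add, pow_one, ← mul_assoc, h.mul_eq, mul_assoc, h.isGDrazinInverse.one_sub_mul_inverse,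
      mul_zero]
  | succ k ih =>
    calc b * (a ^ (k + 1 + 1) * B) = b * a * a ^ (k + 1) * B := by
          rw [pow_succ' a (k + 1)]; simp only [mul_assoc]
      _ = (1 - b * B) * a * b * ((1 - b * B) * a * a ^ k) * B := by
          rw [h.mul_eq, pow_succ']; simp only [mul_assoc]
      _ = (1 - b * B) * a * (b * (a ^ (k + 1) * B)) := by
          rw [h.one_sub_mul, pow_succ']; simp only [mul_assoc]
      _ = 0 := by rw [ih, mul_zero]

theorem add_pow_mul (h : IsQuasinilpotentPerturbation a b B) (n k : ℕ) :
    (a + b) ^ n * (a ^ (k + 1) * B) = a ^ (n + k + 1) * B := by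
  induction n with
  | zero => rw [pow_zero, one_mul, zero_add]
  | succ n ih =>
    rw [pow_succ', mul_assoc, ih, add_mul, h.mul_mul_pow_mul_inverse, add_zero, ← mul_assoc,
      ← pow_succ', add_right_comm n k 1]

theorem inverse_pow_mul_resolvent (h : IsQuasinilpotentPerturbation a b B)
    (hT : HasSum (fun n : ℕ => a ^ n * B ^ (n + 1)) T) (m : ℕ) : B ^ (m + 1) * T = B ^ (m + 2) := by
  have hterm (n : ℕ) (hn : n ≠ 0) : B ^ (m + 1) * (a ^ n * B ^ (n + 1)) = 0 := by
    obtain ⟨n, rfl⟩ := Nat.exists_eq_succ_of_ne_zero hn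
    rw [pow_succ, pow_succ', mul_assoc, mul_assoc, ← mul_assoc B a, h.inverse_mul_eq_zero,
      zero_mul, mul_zero]
  refine ((hT.mul_left _).unique (hasSum_single 0 hterm)).trans ?_
  rw [pow_zero, one_mul, zero_add, pow_one, ← pow_succ]

theorem hasSum_pow (h : IsQuasinilpotentPerturbation a b B)
    (hT : HasSum (fun n : ℕ => a ^ n * B ^ (n + 1)) T) (m : ℕ) :
    HasSum (fun n : ℕ => a ^ n * B ^ (n + m + 1)) (T ^ (m + 1)) := by
  induction m with
  | zero => simpa only [add_zero, zero_add, pow_one] using hT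
  | succ m ih =>
    rw [pow_succ]
    refine (ih.mul_right T).congr_fun fun n => ?_
    rw [mul_assoc, h.inverse_pow_mul_resolvent hT]
    rfl

theorem add_mul_resolvent (h : IsQuasinilpotentPerturbation a b B)
    (hT : HasSum (fun n : ℕ => a ^ n * B ^ (n + 1)) T) : (a + b) * T = b * B + a * T := by
  have hterm (n : ℕ) (hn : n ≠ 0) : b * (a ^ n * B ^ (n + 1)) = 0 := by
    obtain ⟨n, rfl⟩ := Nat.exists_eq_succ_of_ne_zero hn
    rw [pow_succ' B, ← mul_assoc (a ^ _), ← mul_assoc, h.mul_mul_pow_mul_inverse, zero_mul]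
  have hbT := (hT.mul_left b).unique (hasSum_single 0 hterm)
  rw [add_mul, add_comm, hbT, pow_zero, one_mul, zero_add, pow_one]

theorem resolvent_mul_add (h : IsQuasinilpotentPerturbation a b B)
    (hT : HasSum (fun n : ℕ => a ^ n * B ^ (n + 1)) T) : T * (a + b) = b * B + a * T := by
  have hTa : T * a = 0 := mul_eq_zero_of_hasSum' hT fun n => by
    rw [pow_succ, mul_assoc, mul_assoc, h.inverse_mul_eq_zero, mul_zero, mul_zero]
  have haT : HasSum (fun n : ℕ => a ^ (n + 1) * B ^ (n + 1 + 1) * b) (a * T) := by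
    refine (hT.mul_left a).congr_fun fun n => ?_
    rw [mul_assoc, h.isGDrazinInverse.inverse_pow_mul_self, pow_succ', mul_assoc]
  rw [mul_add, hTa, zero_add, (hT.mul_right b).unique (HasSum.zero_add haT), pow_zero, one_mul,
    zero_add, pow_one, h.isGDrazinInverse.comm]

variable [CompleteSpace A]

theorem isQuasinilpotent_add_mul_one_sub (h : IsQuasinilpotentPerturbation a b B) :
    IsQuasinilpotent ((a + b) * (1 - b * B)) := by
  have ha : IsQuasinilpotent (a * (1 - b * B)) := by
    rw [isQuasinilpotent_mul_comm, h.one_sub_mul]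
    exact h.quasinil
  have hcomm : Commute (a * (1 - b * B)) (b * (1 - b * B)) := by
    calc a * (1 - b * B) * (b * (1 - b * B))
        = a * b * ((1 - b * B) * (1 - b * B)) := by
          rw [mul_assoc, ← mul_assoc _ b, ← h.isGDrazinInverse.commute_one_sub.eq]
          simp only [mul_assoc]
      _ = (b * a) * (1 - b * B) := by
          rw [h.mul_eq, h.one_sub_mul, mul_assoc (a * b)]
      _ = b * (1 - b * B) * (a * (1 - b * B)) := by
          rw [mul_assoc b (1 - _), ← mul_assoc _ a, h.one_sub_mul, mul_assoc]
  rw [add_mul]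
  exact ha.add_of_commute h.isGDrazinInverse.isQuasinilpotent_mul_one_sub hcomm

theorem summable (h : IsQuasinilpotentPerturbation a b B) :
    Summable fun n : ℕ => a ^ n * B ^ (n + 1) := by
  simpa only [pow_succ', mul_assoc] using h.quasinil.summable_pow_mul_mul_pow B B

theorem isGDrazinInverse_add (h : IsQuasinilpotentPerturbation a b B)
    (hT : HasSum (fun n : ℕ => a ^ n * B ^ (n + 1)) T) : IsGDrazinInverse (a + b) T := by
  have hTB : T * (1 - b * B) = 0 := mul_eq_zero_of_hasSum' hT fun n => by
    rw [pow_succ, mul_assoc, mul_assoc, h.isGDrazinInverse.inverse_mul_one_sub, mul_zero, mul_zero]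
  have hTa : T * a = 0 := mul_eq_zero_of_hasSum' hT fun n => by
    rw [pow_succ, mul_assoc, mul_assoc, h.inverse_mul_eq_zero, mul_zero, mul_zero]
  have hmul : (a + b) * T = b * B + a * T := h.add_mul_resolvent hT
  refine .of_isQuasinilpotent_mul_one_sub ?_ (hmul.trans (h.resolvent_mul_add hT).symm) ?_
  · rw [mul_sub, mul_one, sub_eq_zero] at hTB
    rw [mul_assoc, hmul, mul_add, ← hTB, ← mul_assoc, hTa, zero_mul, add_zero]
  · have hfactor : 1 - (a + b) * T = (1 - b * B) * (1 - a * T) := by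
      rw [hmul, mul_sub, mul_one, ← mul_assoc _ a, h.one_sub_mul, sub_sub]
    have habsorb : (1 - a * T) * ((a + b) * (1 - b * B)) = (a + b) * (1 - b * B) := by
      rw [sub_mul, one_mul, mul_assoc a, ← mul_assoc T, h.resolvent_mul_add hT, ← hmul, mul_assoc,
        hTB, mul_zero, mul_zero, sub_zero]
    rw [hfactor, ← mul_assoc, isQuasinilpotent_mul_comm, habsorb]
    exact h.isQuasinilpotent_add_mul_one_sub

end IsQuasinilpotentPerturbation

/-- The paper's hypotheses with `u` in the place of `a^π` and `B` in the place of `b^d`. The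
relation `SemiconjBy u w (u * w)`, that is `u * w = u * w * u`, says that `w` is block triangular
with respect to `u`. -/
structure IsCornerPerturbation {A : Type*} [NormedRing A] [NormedAlgebra ℂ A]
    (u a b B : A) : Prop where
  isIdempotentElem : IsIdempotentElem u
  commute : Commute u a
  semiconjBy : SemiconjBy u b (u * b)
  semiconjBy_inverse : SemiconjBy u B (u * B)
  quasinil : IsQuasinilpotent (u * a)
  isGDrazinInverse : IsGDrazinInverse b B
  mul_eq : u * b * a = u * (1 - b * B) * a * b * (1 - b * B) * u

namespace IsCornerPerturbation

variable {A : Type*} [NormedRing A] [NormedAlgebra ℂ A] {u a b B T X : A}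

theorem semiconjBy_left (h : IsCornerPerturbation u a b B) : SemiconjBy u a (u * a) := by
  rw [SemiconjBy, mul_assoc, ← h.commute.eq, ← mul_assoc, h.isIdempotentElem.eq]

theorem semiconjBy_add (h : IsCornerPerturbation u a b B) : SemiconjBy u (a + b) (u * (a + b)) :=
  mul_add u a b ▸ h.semiconjBy_left.add_right h.semiconjBy

theorem mul_pow_mul_inverse_pow (h : IsCornerPerturbation u a b B) (n m : ℕ) :
    (u * a) ^ n * (u * B) ^ (m + 1) = u * a ^ n * B ^ (m + 1) := by
  rw [mul_pow_succ_of_semiconjBy h.semiconjBy_inverse,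
    mul_pow_mul_mul_of_semiconjBy h.semiconjBy_left, mul_assoc]

theorem one_sub_mul_add_mul (h : IsCornerPerturbation u a b B) :
    (1 - u) * (a + b) * u = (1 - u) * b * u := by
  rw [mul_add, add_mul, mul_assoc _ a, ← h.commute.eq, ← mul_assoc,
    h.isIdempotentElem.one_sub_mul_self, zero_mul, zero_add]

theorem mul_one_sub_mul_add_mul (h : IsCornerPerturbation u a b B) {c : A} (hc : c * u = 0) :
    c * ((1 - u) * (a + b) * u) = c * b * u := by
  rw [h.one_sub_mul_add_mul, ← mul_assoc, ← mul_assoc, mul_sub, hc, mul_one, sub_zero]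

theorem mul_add_pow_mul_mul (h : IsCornerPerturbation u a b B) (n : ℕ) (t : A) :
    u * (a + b) ^ n * (u * t) = u * ((a + b) ^ n * t) := by
  rw [(h.semiconjBy_add.pow_right n).eq, mul_assoc, ← mul_assoc u u, h.isIdempotentElem.eq,
    mul_pow_mul_mul_of_semiconjBy h.semiconjBy_add]

theorem hasSum_resolvent (h : IsCornerPerturbation u a b B)
    (hT : HasSum (fun n : ℕ => u * a ^ n * B ^ (n + 1)) T) :
    HasSum (fun n : ℕ => (u * a) ^ n * (u * B) ^ (n + 1)) T := by
  simpa only [h.mul_pow_mul_inverse_pow] using hT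

theorem mul_resolvent (h : IsCornerPerturbation u a b B)
    (hT : HasSum (fun n : ℕ => u * a ^ n * B ^ (n + 1)) T) : u * T = T :=
  (hT.mul_left u).unique (by simpa only [← mul_assoc, h.isIdempotentElem.eq] using hT)

theorem hasSum_mul_pow_mul_resolvent (h : IsCornerPerturbation u a b B)
    (hT : HasSum (fun n : ℕ => u * a ^ n * B ^ (n + 1)) T) (c : A) (n : ℕ) :
    HasSum (fun k : ℕ => c * u * (a + b) ^ n * a ^ (k + 1) * B ^ (k + 1))
      (c * u * (a + b) ^ n * a * T) := by
  refine (hT.mul_left (c * u * (a + b) ^ n * a)).congr_fun fun k => ?_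
  calc c * u * (a + b) ^ n * a ^ (k + 1) * B ^ (k + 1)
      = c * (u * ((a + b) ^ n * (a * (a ^ k * B ^ (k + 1))))) := by
        simp only [pow_succ' a, mul_assoc]
    _ = c * (u * (a + b) ^ n * (u * a * (a ^ k * B ^ (k + 1)))) := by
        rw [mul_assoc u a, h.mul_add_pow_mul_mul]
    _ = c * u * (a + b) ^ n * a * (u * a ^ k * B ^ (k + 1)) := by
        rw [h.commute.eq]
        simp only [mul_assoc]

theorem one_sub_mul_add_mul_one_sub (h : IsCornerPerturbation u a b B) :
    (1 - u) * (a + b) * (1 - u) = (a + b) * (1 - u) :=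
  one_sub_mul_mul_one_sub h.semiconjBy_add

theorem inverse_mul_eq_zero (h : IsCornerPerturbation u a b B) {e : A}
    (he : e = (a + b) * (1 - u)) (hX : IsGDrazinInverse e X) : X * u = 0 :=
  hX.inverse_mul_eq_zero <| by
    rw [he, mul_assoc, h.isIdempotentElem.one_sub_mul_self, mul_zero]

variable [CompleteSpace A]

theorem isQuasinilpotentPerturbation (h : IsCornerPerturbation u a b B) :
    IsQuasinilpotentPerturbation (u * a) (u * b) (u * B) where
  quasinil := h.quasinil
  isGDrazinInverse := h.isGDrazinInverse.mul_left h.semiconjBy h.semiconjBy_inverse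
  mul_eq := by
    have hbB : SemiconjBy u (b * B) (u * (b * B)) :=
      semiconjBy_mul_mul h.semiconjBy h.semiconjBy_inverse
    have hf : SemiconjBy u (1 - b * B) (u * (1 - b * B)) := by
      rw [SemiconjBy, mul_sub, mul_one, sub_mul, ← hbB.eq, h.isIdempotentElem.eq]
    have hab := semiconjBy_mul_mul h.semiconjBy_left h.semiconjBy
    have hleft (t : A) : (1 - u * (b * B)) * (u * t) = u * ((1 - b * B) * t) := by
      rw [sub_mul, mul_mul_mul_of_semiconjBy hbB, sub_mul, mul_sub, one_mul, one_mul]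
    have hright : u * (a * b) * (1 - u * (b * B)) = u * (a * b * (1 - b * B)) := by
      rw [mul_sub, mul_mul_mul_of_semiconjBy hab, mul_sub (a * b), mul_sub, mul_one, mul_one]
    calc u * b * (u * a) = u * ((1 - b * B) * (a * b * (1 - b * B))) * u := by
          rw [mul_mul_mul_of_semiconjBy h.semiconjBy, ← mul_assoc, h.mul_eq]
          simp only [mul_assoc]
      _ = (1 - u * (b * B)) * (u * (a * b) * (1 - u * (b * B))) := by
          rw [hright, hleft, ← (semiconjBy_mul_mul hf (semiconjBy_mul_mul hab hf)).eq]
      _ = (1 - u * b * (u * B)) * (u * a) * (u * b) * (1 - u * b * (u * B)) := by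
          rw [mul_mul_mul_of_semiconjBy h.semiconjBy, mul_assoc _ (u * a),
            mul_mul_mul_of_semiconjBy h.semiconjBy_left]
          simp only [mul_assoc]

theorem summable_resolvent (h : IsCornerPerturbation u a b B) :
    Summable fun n : ℕ => u * a ^ n * B ^ (n + 1) := by
  simpa only [h.mul_pow_mul_inverse_pow] using h.isQuasinilpotentPerturbation.summable

theorem isGDrazinInverse_mul_add (h : IsCornerPerturbation u a b B)
    (hT : HasSum (fun n : ℕ => u * a ^ n * B ^ (n + 1)) T) : IsGDrazinInverse (u * (a + b)) T :=
  mul_add u a b ▸ h.isQuasinilpotentPerturbation.isGDrazinInverse_add (h.hasSum_resolvent hT)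

theorem hasSum_mul_resolvent_pow (h : IsCornerPerturbation u a b B)
    (hT : HasSum (fun n : ℕ => u * a ^ n * B ^ (n + 1)) T) (c : A) (n : ℕ) :
    HasSum (fun k : ℕ => c * a ^ k * u * B ^ (n + k + 2)) (c * T ^ (n + 2)) := by
  have hpow := h.isQuasinilpotentPerturbation.hasSum_pow (h.hasSum_resolvent hT) (n + 1)
  refine (hpow.mul_left c).congr_fun fun k => ?_
  rw [h.mul_pow_mul_inverse_pow, mul_assoc c, ← (h.commute.pow_right k).eq, ← add_assoc,
    add_comm k n, mul_assoc]

theorem mul_pow_mul_one_sub_resolvent (h : IsCornerPerturbation u a b B)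
    (hT : HasSum (fun n : ℕ => u * a ^ n * B ^ (n + 1)) T) (n : ℕ) :
    u * (u * (a + b)) ^ n * (1 - u * (a + b) * T)
      = u * (a + b) ^ n * (1 - b * B) - u * (a + b) ^ n * a * T := by
  have hcomm : Commute u (u * (a + b)) := by
    rw [Commute, SemiconjBy, ← mul_assoc, h.isIdempotentElem.eq, ← h.semiconjBy_add.eq]
  have hresolvent : u * (1 - u * (a + b) * T) = u * (1 - b * B - a * T) := by
    have hadd := h.isQuasinilpotentPerturbation.add_mul_resolvent (h.hasSum_resolvent hT)
    rw [← mul_add, mul_mul_mul_of_semiconjBy h.semiconjBy] at hadd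
    rw [hadd, mul_sub, mul_add, mul_assoc u a, ← mul_assoc u u, ← mul_assoc u u,
      h.isIdempotentElem.eq]
    noncomm_ring
  calc u * (u * (a + b)) ^ n * (1 - u * (a + b) * T)
      = u * ((a + b) ^ n * (1 - b * B - a * T)) := by
        rw [(hcomm.pow_right n).eq, mul_assoc, hresolvent,
          mul_pow_mul_mul_of_semiconjBy h.semiconjBy_add]
    _ = u * (a + b) ^ n * (1 - b * B) - u * (a + b) ^ n * a * T := by noncomm_ring

theorem summable_sylvester_resolvent (h : IsCornerPerturbation u a b B) {e : A}
    (hX : IsGDrazinInverse e X) (c : A) :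
    Summable fun q : ℕ × ℕ =>
      (1 - e * X) * e ^ q.1 * c * a ^ q.2 * u * B ^ (q.1 + q.2 + 2) := by
  refine (hX.isQuasinilpotent_mul_one_sub.summable_pow_mul_pow_mul_pow_add h.quasinil
    ((1 - e * X) * c) ((u * B) ^ 2) (u * B)).congr fun ⟨n, k⟩ => ?_
  calc (e * (1 - e * X)) ^ n * ((1 - e * X) * c) * (u * a) ^ k * (u * B) ^ 2 * (u * B) ^ (n + k)
      = (e * (1 - e * X)) ^ n * (1 - e * X) * c * ((u * a) ^ k * (u * B) ^ (n + k + 2)) := by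
        rw [mul_assoc _ ((u * B) ^ 2), ← pow_add, add_comm 2]
        simp only [mul_assoc]
    _ = (1 - e * X) * e ^ n * c * a ^ k * u * B ^ (n + k + 2) := by
        rw [← hX.pow_mul_one_sub, (hX.commute_one_sub.pow_left n).eq, h.mul_pow_mul_inverse_pow,
          (h.commute.pow_right k).eq]
        simp only [mul_assoc]

theorem summable_pow_mul_resolvent (h : IsCornerPerturbation u a b B) (x c : A) :
    Summable fun q : ℕ × ℕ =>
      x ^ (q.1 + 2) * c * u * (a + b) ^ q.1 * a ^ (q.2 + 1) * B ^ (q.2 + 1) := by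
  refine (h.quasinil.summable_pow_mul_pow_add_mul_pow x (x ^ 2 * c) (u * a * (u * B))
    (u * B)).congr fun ⟨n, k⟩ => ?_
  calc x ^ n * (x ^ 2 * c) * (u * a) ^ (n + k) * (u * a * (u * B)) * (u * B) ^ k
      = x ^ (n + 2) * c * ((u * a) ^ (n + k + 1) * (u * B)) * (u * B) ^ k := by
        simp only [pow_succ, pow_zero, one_mul, pow_add, mul_assoc]
    _ = x ^ (n + 2) * c * ((u * (a + b)) ^ n * ((u * a) ^ (k + 1) * (u * B) ^ (k + 1))) := by
        rw [← h.isQuasinilpotentPerturbation.add_pow_mul, mul_add, pow_succ' (u * B)]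
        simp only [mul_assoc]
    _ = x ^ (n + 2) * c * u * (a + b) ^ n * a ^ (k + 1) * B ^ (k + 1) := by
        rw [h.mul_pow_mul_inverse_pow, mul_assoc u, mul_pow_mul_mul_of_semiconjBy h.semiconjBy_add]
        simp only [mul_assoc]

theorem mul_off_mul_pow_mul_one_sub (h : IsCornerPerturbation u a b B)
    (hT : HasSum (fun n : ℕ => u * a ^ n * B ^ (n + 1)) T) {c : A} (hc : c * u = 0) (n : ℕ) :
    c * ((1 - u) * (a + b) * u) * (u * (a + b)) ^ n * (1 - u * (a + b) * T)
      = c * b * u * (a + b) ^ n * (1 - b * B) - c * b * u * (a + b) ^ n * a * T := by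
  calc c * ((1 - u) * (a + b) * u) * (u * (a + b)) ^ n * (1 - u * (a + b) * T)
      = c * b * (u * (u * (a + b)) ^ n * (1 - u * (a + b) * T)) := by
        rw [h.mul_one_sub_mul_add_mul hc]
        simp only [mul_assoc]
    _ = c * b * u * (a + b) ^ n * (1 - b * B) - c * b * u * (a + b) ^ n * a * T := by
        rw [h.mul_pow_mul_one_sub_resolvent hT, mul_sub]
        simp only [mul_assoc]

theorem hasSum_pow_mul_resolvent (h : IsCornerPerturbation u a b B)
    (hT : HasSum (fun n : ℕ => u * a ^ n * B ^ (n + 1)) T) (x c : A) :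
    HasSum (fun n : ℕ => x ^ (n + 2) * c * u * (a + b) ^ n * a * T)
      (∑' n : ℕ, ∑' k : ℕ,
        x ^ (n + 2) * c * u * (a + b) ^ n * a ^ (k + 1) * B ^ (k + 1)) := by
  refine (h.summable_pow_mul_resolvent x c).prod.hasSum.congr_fun fun n => ?_
  exact (h.hasSum_mul_pow_mul_resolvent hT _ n).tsum_eq.symm

theorem summable_pow_mul_pow_mul_one_sub (h : IsCornerPerturbation u a b B) {x : A}
    (hx : x * u = 0) :
    Summable fun n : ℕ => x ^ (n + 2) * b * u * (a + b) ^ n * (1 - b * B) := by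
  have hT := h.summable_resolvent.hasSum
  refine (((h.isGDrazinInverse_mul_add hT).summable_sylvester' x ((1 - u) * (a + b) * u)).add
    (h.hasSum_pow_mul_resolvent hT x b).summable).congr fun n => ?_
  rw [h.mul_off_mul_pow_mul_one_sub hT (by rw [pow_succ, mul_assoc, hx, mul_zero]), sub_add_cancel]

variable {e : A}

theorem isGDrazinInverse_add (h : IsCornerPerturbation u a b B) (he : e = (a + b) * (1 - u))
    (hX : IsGDrazinInverse e X) :
    IsGDrazinInverse (a + b) (X
      + ∑' n : ℕ, u * a ^ n * B ^ (n + 1)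
      - ∑' n : ℕ, X * b * u * a ^ n * B ^ (n + 1)
      + ∑' n : ℕ, ∑' k : ℕ,
          (1 - e * X) * e ^ n * (1 - u) * b * a ^ k * u * B ^ (n + k + 2)
      + ∑' n : ℕ, X ^ (n + 2) * b * u * (a + b) ^ n * (1 - b * B)
      - ∑' n : ℕ, ∑' k : ℕ, X ^ (n + 2) * b * u * (a + b) ^ n * a ^ (k + 1) * B ^ (k + 1)) := by
  have hT := h.summable_resolvent.hasSum
  set T := ∑' n : ℕ, u * a ^ n * B ^ (n + 1)
  have hXu : X * u = 0 := h.inverse_mul_eq_zero he hX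
  have hXT : ∑' n : ℕ, X * b * u * a ^ n * B ^ (n + 1) = X * ((1 - u) * (a + b) * u) * T := by
    calc ∑' n : ℕ, X * b * u * a ^ n * B ^ (n + 1) = X * b * T := by
          simpa only [← mul_assoc] using (hT.mul_left (X * b)).tsum_eq
      _ = X * ((1 - u) * (a + b) * u) * T := by
          rw [h.mul_one_sub_mul_add_mul hXu, mul_assoc (X * b), h.mul_resolvent hT]
  have hR : HasSum (fun n : ℕ => (1 - e * X) * e ^ n * ((1 - u) * (a + b) * u) * T ^ (n + 2))
      (∑' n : ℕ, ∑' k : ℕ,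
        (1 - e * X) * e ^ n * (1 - u) * b * a ^ k * u * B ^ (n + k + 2)) := by
    convert (hX.summable_sylvester ((1 - u) * (a + b) * u) T).hasSum using 3 with n
    rw [(h.hasSum_mul_resolvent_pow hT _ n).tsum_eq, h.one_sub_mul_add_mul, pow_succ' T,
      ← mul_assoc _ T, ← mul_assoc _ T, ← mul_assoc _ _ u, mul_assoc _ u T, h.mul_resolvent hT,
      ← mul_assoc _ _ b]
  have hS := ((h.summable_pow_mul_pow_mul_one_sub hXu).hasSum.sub
    (h.hasSum_pow_mul_resolvent hT X b)).congr_fun fun n =>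
      h.mul_off_mul_pow_mul_one_sub hT (by rw [pow_succ, mul_assoc, hXu, mul_zero]) n
  have htri := IsBlockTriangular.of_semiconjBy h.isIdempotentElem h.semiconjBy_add
  rw [← he] at htri
  convert htri.isGDrazinInverse_add hX (h.isGDrazinInverse_mul_add hT) hS hR using 1
  · rw [he, mul_one_sub_add_mul_add h.semiconjBy_add]
  · rw [hXT]
    abel

theorem isGDrazinInvertible_add_iff (h : IsCornerPerturbation u a b B)
    (he : e = (a + b) * (1 - u)) : IsGDrazinInvertible (a + b) ↔ IsGDrazinInvertible e := by
  refine ⟨fun ⟨W, hW⟩ => ?_, fun ⟨X, hX⟩ => ⟨_, h.isGDrazinInverse_add he hX⟩⟩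
  have hblock := h.isGDrazinInverse_mul_add h.summable_resolvent.hasSum
  exact he ▸ ⟨_, hW.mul_right_one_sub h.semiconjBy_add
    (hW.semiconjBy_of_isGDrazinInvertible_mul h.semiconjBy_add ⟨_, hblock⟩)⟩

end IsCornerPerturbation

theorem isCornerPerturbation_spectralIdem {A : Type*} [NormedRing A] [NormedAlgebra ℂ A]
    [CompleteSpace A] {a b : A}
    (ha : IsGDrazinInvertible a) (hb : IsGDrazinInvertible b)
    (hab : spectralIdem a * b * a =
      spectralIdem a * spectralIdem b * a * b * spectralIdem b * spectralIdem a)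
    (hcorner :
      IsGDrazinInvertible (spectralIdem a * b * spectralIdem a) ∨
      IsGDrazinInvertible (spectralIdem a * b) ∨
      IsGDrazinInvertible (b * spectralIdem a) ∨
      IsGDrazinInvertible (a * gDrazin a * b * (a * gDrazin a)) ∨
      IsGDrazinInvertible (a * gDrazin a * b) ∨
      IsGDrazinInvertible (b * (a * gDrazin a))) :
    IsCornerPerturbation (spectralIdem a) a b (gDrazin b) := by
  have ha' := gDrazin_spec ha
  have hb' := gDrazin_spec hb
  have hcomm : Commute (spectralIdem a) a := ha'.commute_one_sub.symm
  have hvanish : spectralIdem a * gDrazin a = 0 := ha'.one_sub_mul_inverse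
  have hsemiconj : SemiconjBy (spectralIdem a) b (spectralIdem a * b) := by
    have hzero : spectralIdem a * b * (a * gDrazin a) = 0 := by
      rw [← mul_assoc, hab, mul_assoc, hvanish, mul_zero]
    rw [← sub_sub_cancel 1 (a * gDrazin a), mul_sub, mul_one, sub_eq_zero] at hzero
    exact hzero
  rw [← sub_sub_cancel 1 (a * gDrazin a)] at hcorner
  exact {
    isIdempotentElem := ha'.isIdempotentElem.one_sub
    commute := hcomm
    semiconjBy := hsemiconj
    semiconjBy_inverse := hb'.semiconjBy_of_corner hsemiconj hcorner
    quasinil := hcomm.eq ▸ ha'.isQuasinilpotent_mul_one_sub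
    isGDrazinInverse := hb'
    mul_eq := hab }

theorem corollary2p6 {A : Type*} [NormedRing A] [NormedAlgebra ℂ A] [CompleteSpace A]
    (a b e : A) (ha : IsGDrazinInvertible a) (hb : IsGDrazinInvertible b)
    (hab : spectralIdem a * b * a =
      spectralIdem a * spectralIdem b * a * b * spectralIdem b * spectralIdem a)
    (hcorner :
      IsGDrazinInvertible (spectralIdem a * b * spectralIdem a) ∨
      IsGDrazinInvertible (spectralIdem a * b) ∨
      IsGDrazinInvertible (b * spectralIdem a) ∨
      IsGDrazinInvertible (a * gDrazin a * b * (a * gDrazin a)) ∨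
      IsGDrazinInvertible (a * gDrazin a * b) ∨
      IsGDrazinInvertible (b * (a * gDrazin a)))
    (he : e = (a + b) * (a * gDrazin a)) :
    [IsGDrazinInvertible (a + b),
      IsGDrazinInvertible (a * gDrazin a * (a + b)),
      IsGDrazinInvertible e,
      IsGDrazinInvertible (a * gDrazin a * (a + b) * (a * gDrazin a))].TFAE ∧
    (IsGDrazinInvertible (a + b) →
      Summable (fun n : ℕ => spectralIdem a * a ^ n * gDrazin b ^ (n + 1)) ∧
      Summable (fun n : ℕ =>
        gDrazin e * b * spectralIdem a * a ^ n * gDrazin b ^ (n + 1)) ∧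
      Summable (fun q : ℕ × ℕ =>
        spectralIdem e * e ^ q.1 * (a * gDrazin a) * b * a ^ q.2 * spectralIdem a *
          gDrazin b ^ (q.1 + q.2 + 2)) ∧
      Summable (fun n : ℕ =>
        gDrazin e ^ (n + 2) * b * spectralIdem a * (a + b) ^ n * spectralIdem b) ∧
      Summable (fun q : ℕ × ℕ =>
        gDrazin e ^ (q.1 + 2) * b * spectralIdem a * (a + b) ^ q.1 * a ^ (q.2 + 1) *
          gDrazin b ^ (q.2 + 1)) ∧
      gDrazin (a + b) =
        gDrazin e
        + ∑' n : ℕ, spectralIdem a * a ^ n * gDrazin b ^ (n + 1)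
        - ∑' n : ℕ, gDrazin e * b * spectralIdem a * a ^ n * gDrazin b ^ (n + 1)
        + ∑' n : ℕ, ∑' k : ℕ,
            spectralIdem e * e ^ n * (a * gDrazin a) * b * a ^ k * spectralIdem a *
              gDrazin b ^ (n + k + 2)
        + ∑' n : ℕ,
            gDrazin e ^ (n + 2) * b * spectralIdem a * (a + b) ^ n * spectralIdem b
        - ∑' n : ℕ, ∑' k : ℕ,
            gDrazin e ^ (n + 2) * b * spectralIdem a * (a + b) ^ n * a ^ (k + 1) *
              gDrazin b ^ (k + 1)) := by
  have h := isCornerPerturbation_spectralIdem ha hb hab hcorner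
  rw [show a * gDrazin a = 1 - spectralIdem a from (sub_sub_cancel _ _).symm] at he ⊢
  have hadd_iff := h.isGDrazinInvertible_add_iff he
  refine ⟨?_, fun hadd => ?_⟩
  · rw [h.one_sub_mul_add_mul_one_sub, ← he]
    tfae_have 1 ↔ 3 := hadd_iff
    tfae_have 2 ↔ 3 := he ▸ isGDrazinInvertible_mul_comm
    tfae_have 3 ↔ 4 := Iff.rfl
    tfae_finish
  · have hX := gDrazin_spec (hadd_iff.1 hadd)
    have hXu := h.inverse_mul_eq_zero he hX
    have hterm (n : ℕ) :
        gDrazin e * b * spectralIdem a * a ^ n * gDrazin b ^ (n + 1) =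
          gDrazin e * b * (spectralIdem a * a ^ n * gDrazin b ^ (n + 1)) := by
      simp only [mul_assoc]
    refine ⟨h.summable_resolvent, ?_, ?_, h.summable_pow_mul_pow_mul_one_sub hXu,
      h.summable_pow_mul_resolvent _ _, ?_⟩
    · simpa only [hterm] using h.summable_resolvent.mul_left _
    · simpa only [spectralIdem, mul_assoc] using
        h.summable_sylvester_resolvent hX ((1 - spectralIdem a) * b)
    · exact (h.isGDrazinInverse_add he hX).gDrazin_eq
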